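/- A \emph{type} is a pair $\mathsf A=(\alpha,K)$ of a (strictly) linearly ordered set $\alpha$ and a set $K$ of constant symbols (not containing $0,1$). An \emph{$\mathsf A$-algebra} is a Boolean algebra $\mathfrak A$ with a unary operation $\Diamond_i$ for each $i\in\alpha$ and a distinguished element $c^{\mathfrak A}$ for each $c\in K$, such that, with $\Box_i x=\overline{\Diamond_i\overline{x}}$, for all $x,y\in\mathfrak A$ and all $i\in\alpha$: $\Diamond_i0=0$, $\Diamond_i x\vee\Diamond_i y=\Diamond_i(x\vee y)$, $\Diamond_i(\overline{\Diamond_i x}\wedge x)=\Diamond_i x$, and, for $i<j$ in $\alpha$, $\Diamond_j x\le\Diamond_i x$ and $\Diamond_i x\le\Box_j\Diamond_i x$. Homomorphisms preserve all operations and constants. For $i\in\alpha$ put $$x\vartriangleleft_i y\iff y\le\Diamond_i x,\qquad x\equiv_i y\iff \Diamond_i x\vee x=\Diamond_i y\vee y .$$ The algebra $\mathfrak A$ is \emph{linear} if $\bigcup_{i\in\alpha}(\vartriangleleft_i\cup\equiv_i)$ is a linear (i.e. total) preorder on $\mathfrak A$ and $\bigcup_{i\in\alpha}\vartriangleleft_i\,\cap\,\bigcup_{i\in\alpha}\equiv_i\;=\{(0,0)\}$.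 A \emph{type embedding} $l\colon(\alpha,K)\to(\beta,L)$ consists of a strictly monotone map $f\colon\alpha\to\beta$ and an injection $g\colon K\to L$. It is \emph{final} if $\alpha$ has a least element, $g$ is a bijection, and $f(\alpha)$ is a final interval (upward closed subset) of $\beta$. For a $(\beta,L)$-algebra $\mathfrak C$ its \emph{$l$-puration} $P^l(\mathfrak C)$ is the $(\alpha,K)$-algebra with the same underlying Boolean algebra in which $\Diamond_i$ is interpreted as $\Diamond_{f(i)}^{\mathfrak C}$ and $c$ as $g(c)^{\mathfrak C}$. A \emph{free $l$-extension} of an $(\alpha,K)$-algebra $\mathfrak A$ is a $(\beta,L)$-algebra $F^l(\mathfrak A)$ with a homomorphism $e\colon\mathfrak A\to P^l(F^l(\mathfrak A))$ such that for every $(\beta,L)$-algebra $\mathfrak C$ and every homomorphism $h_0\colon\mathfrak A\to P^l(\mathfrak C)$ there is a unique homomorphism $h\colon F^l(\mathfrak A)\to\mathfrak C$ with $h\circ e=h_0$ as maps; it exists and is unique up to isomorphism. \textbf{Lemma.} Let $l\colon\mathsf A\to\mathsf B$ be a final type embedding and let $\mathfrak A$ be a linear $\mathsf A$-algebra. Then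 the free $l$-extension $F^l(\mathfrak A)$ is linear. Moreover, for every nonempty linearly ordered set $\alpha$, the free $\emptyset$-generated $\mathsf{GLP}_\alpha$-algebra (the $(\alpha,\emptyset)$-algebra that has exactly one homomorphism to every $(\alpha,\emptyset)$-algebra) is linear. -/

import Mathlib

universe u v w x

/-- `X` is a GLP-algebra of the type `(α, K)`: a Boolean algebra with an operator `◇ i` for every
element `i` of the linear order `α` and a distinguished element for every constant symbol in `K`.
The symbols `⊥`, `⊤` are not among the constant symbols. -/
class GLPAlgebra (α : Type*) (K : Type*) [LinearOrder α] (X : Type*) [BooleanAlgebra X] where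
  /-- the operators `◇ i` -/
  dia : α → X → X
  /-- the interpretation of the constant symbols -/
  const : K → X
  dia_bot : ∀ i, dia i ⊥ = ⊥
  dia_sup : ∀ i x y, dia i x ⊔ dia i y = dia i (x ⊔ y)
  dia_loeb : ∀ i x, dia i ((dia i x)ᶜ ⊓ x) = dia i x
  dia_anti : ∀ i j x, i < j → dia j x ≤ dia i x
  /-- `◇ i x ≤ □ j (◇ i x)`, where `□ j y = (◇ j yᶜ)ᶜ` -/
  dia_le_box_dia : ∀ i j x, i < j → dia i x ≤ (dia j (dia i x)ᶜ)ᶜ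

/-- Homomorphisms of GLP-algebras of the type `(α, K)`. (Homomorphisms of bounded lattices between
Boolean algebras preserve complements.) -/
structure GLPHom (α : Type*) (K : Type*) [LinearOrder α] (X Y : Type*) [BooleanAlgebra X]
    [BooleanAlgebra Y] [GLPAlgebra α K X] [GLPAlgebra α K Y] extends BoundedLatticeHom X Y where
  map_dia' : ∀ (i : α) (x : X),
    toFun (GLPAlgebra.dia K i x) = GLPAlgebra.dia K i (toFun x)
  map_const' : ∀ c : K, toFun (GLPAlgebra.const α c) = GLPAlgebra.const α c

/-- Type embeddings `(α, K) → (β, L)`. -/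
structure TypeEmbedding (α : Type*) (K : Type*) (β : Type*) (L : Type*)
    [LinearOrder α] [LinearOrder β] where
  /-- the map of the operator indices -/
  idx : α → β
  /-- the map of the constant symbols -/
  cst : K → L
  strictMono_idx : StrictMono idx
  injective_cst : Function.Injective cst

/-- A type embedding is final if the index set of its domain has a least element, it is a bijection
on constant symbols, and it maps the indices onto a final interval. -/
structure TypeEmbedding.IsFinal {α K β L : Type*} [LinearOrder α] [LinearOrder β]
    (l : TypeEmbedding α K β L) : Prop where
  normal : ∃ m : α, IsBot m
  bijective_cst : Function.Bijective l.cst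
  isUpperSet_range : IsUpperSet (Set.range l.idx)

/-- The `l`-puration of an algebra `X` of the type `(β, L)`: the same Boolean algebra, regarded as
an algebra of the type `(α, K)` by interpreting each symbol `s` as `l s` is interpreted in `X`. -/
def Puration {α K β L : Type*} [LinearOrder α] [LinearOrder β]
    (_l : TypeEmbedding α K β L) (X : Type x) : Type x := X

section Puration

variable {α K β L : Type*} [LinearOrder α] [LinearOrder β] (l : TypeEmbedding α K β L)

instance (X : Type*) [BooleanAlgebra X] : BooleanAlgebra (Puration l X) :=
  inferInstanceAs (BooleanAlgebra X)

instance (X : Type*) [BooleanAlgebra X] [GLPAlgebra β L X] : GLPAlgebra α K (Puration l X) where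
  dia i := (GLPAlgebra.dia L (l.idx i) : X → X)
  const c := (GLPAlgebra.const β (l.cst c) : X)
  dia_bot i := GLPAlgebra.dia_bot (K := L) (X := X) (l.idx i)
  dia_sup i := GLPAlgebra.dia_sup (K := L) (X := X) (l.idx i)
  dia_loeb i := GLPAlgebra.dia_loeb (K := L) (X := X) (l.idx i)
  dia_anti i j y h :=
    GLPAlgebra.dia_anti (K := L) (X := X) (l.idx i) (l.idx j) y (l.strictMono_idx h)
  dia_le_box_dia i j y h :=
    GLPAlgebra.dia_le_box_dia (K := L) (X := X) (l.idx i) (l.idx j) y (l.strictMono_idx h)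

/-- The action of the puration on homomorphisms: the same function. -/
def Puration.map {X Y : Type*} [BooleanAlgebra X] [BooleanAlgebra Y] [GLPAlgebra β L X]
    [GLPAlgebra β L Y] (h : GLPHom β L X Y) :
    GLPHom α K (Puration l X) (Puration l Y) where
  toFun := h.toFun
  map_sup' := h.map_sup'
  map_inf' := h.map_inf'
  map_top' := h.map_top'
  map_bot' := h.map_bot'
  map_dia' i := h.map_dia' (l.idx i)
  map_const' c := h.map_const' (l.cst c)

end Puration

/-- `(F, e)` is a free `l`-extension of the algebra `A` of the type `(α, K)`: for every
homomorphism `g` from `A` to the `l`-puration of an algebra `C` there is exactly one homomorphism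
`h : F → C` whose `l`-puration takes `e` to `g`. Here `C` ranges over the universe of `F`, so that
`F` has to be taken in a universe that contains `β`, `L` and `A`. -/
def IsFreeExtension {α K β L : Type*} [LinearOrder α] [LinearOrder β]
    (l : TypeEmbedding α K β L) {A : Type*} [BooleanAlgebra A] [GLPAlgebra α K A]
    {F : Type x} [BooleanAlgebra F] [GLPAlgebra β L F]
    (e : GLPHom α K A (Puration l F)) : Prop :=
  ∀ (C : Type x) [BooleanAlgebra C] [GLPAlgebra β L C] (g : GLPHom α K A (Puration l C)),
    ∃! h : GLPHom β L F C, ∀ a : A, (Puration.map l h).toFun (e.toFun a) = g.toFun a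

/-- `F` is a free `GLP_α`-algebra (no constant symbols) with the family `e` of free generators. -/
def IsFreeGLPAlgebra (α : Type*) [LinearOrder α] {S : Type*}
    {F : Type x} [BooleanAlgebra F] [GLPAlgebra α Empty F] (e : S → F) : Prop :=
  ∀ (C : Type x) [BooleanAlgebra C] [GLPAlgebra α Empty C] (g : S → C),
    ∃! h : GLPHom α Empty F C, ∀ s : S, h.toFun (e s) = g s

section Linear

variable (α K : Type*) [LinearOrder α] {X : Type*} [BooleanAlgebra X] [GLPAlgebra α K X]

variable {α} in
/-- The relation `x ⊲ᵢ y`. -/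
def GLPAlgebra.Tri (i : α) (x y : X) : Prop := y ≤ GLPAlgebra.dia K i x

variable {α} in
/-- The relation `x ≡ᵢ y`. -/
def GLPAlgebra.Sim (i : α) (x y : X) : Prop :=
  GLPAlgebra.dia K i x ⊔ x = GLPAlgebra.dia K i y ⊔ y

/-- The union of the relations `⊲ᵢ ∪ ≡ᵢ` over all indices `i`. -/
def GLPAlgebra.Rel (x y : X) : Prop :=
  ∃ i : α, GLPAlgebra.Tri K i x y ∨ GLPAlgebra.Sim K i x y

variable (X) in
/-- Linear algebras: the union of all `⊲ᵢ` and `≡ᵢ` is a linear (that is, total) preorder, and the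
union of the `⊲ᵢ` meets the union of the `≡ᵢ` in the pair `(⊥, ⊥)` only. -/
structure GLPAlgebra.IsLinear : Prop where
  refl : ∀ x : X, GLPAlgebra.Rel α K x x
  trans : ∀ x y z : X,
    GLPAlgebra.Rel α K x y → GLPAlgebra.Rel α K y z → GLPAlgebra.Rel α K x z
  total : ∀ x y : X, GLPAlgebra.Rel α K x y ∨ GLPAlgebra.Rel α K y x
  inter : (⋃ i : α, {p : X × X | GLPAlgebra.Tri K i p.1 p.2}) ∩
    (⋃ i : α, {p : X × X | GLPAlgebra.Sim K i p.1 p.2}) = {(⊥, ⊥)}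

end Linear

/-! Free extensions and free algebras exist: they are built from terms, two terms being identified
if they have the same value under all admissible valuations. -/

/-- Terms of the type `(β, L)` with variables in `S`. -/
inductive GLPTerm (β : Type*) (L : Type*) (S : Type*)
  | gen (s : S)
  | cst (c : L)
  | bot
  | top
  | inf (t₁ t₂ : GLPTerm β L S)
  | sup (t₁ t₂ : GLPTerm β L S)
  | compl (t : GLPTerm β L S)
  | dia (i : β) (t : GLPTerm β L S)

/-- The value of a term under a valuation of its variables. -/
def GLPTerm.eval {β L S : Type*} [LinearOrder β] {C : Type*} [BooleanAlgebra C]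
    [GLPAlgebra β L C] (e : S → C) : GLPTerm β L S → C
  | .gen s => e s
  | .cst c => GLPAlgebra.const β c
  | .bot => ⊥
  | .top => ⊤
  | .inf t₁ t₂ => t₁.eval e ⊓ t₂.eval e
  | .sup t₁ t₂ => t₁.eval e ⊔ t₂.eval e
  | .compl t => (t.eval e)ᶜ
  | .dia i t => GLPAlgebra.dia L i (t.eval e)

namespace GLPTerm

variable {β L S : Type*} [LinearOrder β]
  (Adm : ∀ (C : Type x) [BooleanAlgebra C] [GLPAlgebra β L C], (S → C) → Prop)

/-- Equality of values under all valuations that are admissible in the sense of `Adm`. -/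
def setoid : Setoid (GLPTerm β L S) where
  r t₁ t₂ := ∀ (C : Type x) [BooleanAlgebra C] [GLPAlgebra β L C] (e : S → C), Adm C e →
    t₁.eval e = t₂.eval e
  iseqv := ⟨fun _ _ _ _ _ _ => rfl, fun h C _ _ e he => (h C e he).symm,
    fun h h' C _ _ e he => (h C e he).trans (h' C e he)⟩

/-- The term algebra. -/
def Alg : Type _ := Quotient (setoid Adm)

instance : BooleanAlgebra (Alg Adm) where
  le := Quotient.lift₂ (fun t₁ t₂ => ∀ (C : Type x) [BooleanAlgebra C] [GLPAlgebra β L C]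
      (e : S → C), Adm C e → t₁.eval e ≤ t₂.eval e) (by
    intro a₁ b₁ a₂ b₂ h₁ h₂
    refine propext ⟨fun h C _ _ e he => ?_, fun h C _ _ e he => ?_⟩
    · rw [← h₁ C e he, ← h₂ C e he]; exact h C e he
    · rw [h₁ C e he, h₂ C e he]; exact h C e he)
  le_refl := by
    rintro ⟨a⟩ C _ _ e he
    exact le_rfl
  le_trans := by
    rintro ⟨a⟩ ⟨b⟩ ⟨c⟩ h h' C _ _ e he
    exact (h C e he).trans (h' C e he)
  le_antisymm := by
    rintro ⟨a⟩ ⟨b⟩ h h'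
    exact Quotient.sound fun C _ _ e he => le_antisymm (h C e he) (h' C e he)
  sup := Quotient.map₂ .sup fun _ _ h _ _ h' C _ _ e he =>
    congrArg₂ (· ⊔ ·) (h C e he) (h' C e he)
  inf := Quotient.map₂ .inf fun _ _ h _ _ h' C _ _ e he =>
    congrArg₂ (· ⊓ ·) (h C e he) (h' C e he)
  compl := Quotient.map .compl fun _ _ h C _ _ e he => congrArg (·ᶜ) (h C e he)
  top := Quotient.mk _ .top
  bot := Quotient.mk _ .bot
  le_sup_left := by
    rintro ⟨a⟩ ⟨b⟩ C _ _ e he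
    exact le_sup_left
  le_sup_right := by
    rintro ⟨a⟩ ⟨b⟩ C _ _ e he
    exact le_sup_right
  sup_le := by
    rintro ⟨a⟩ ⟨b⟩ ⟨c⟩ h h' C _ _ e he
    exact sup_le (h C e he) (h' C e he)
  inf_le_left := by
    rintro ⟨a⟩ ⟨b⟩ C _ _ e he
    exact inf_le_left
  inf_le_right := by
    rintro ⟨a⟩ ⟨b⟩ C _ _ e he
    exact inf_le_right
  le_inf := by
    rintro ⟨a⟩ ⟨b⟩ ⟨c⟩ h h' C _ _ e he
    exact le_inf (h C e he) (h' C e he)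
  le_sup_inf := by
    rintro ⟨a⟩ ⟨b⟩ ⟨c⟩ C _ _ e he
    exact le_sup_inf
  inf_compl_le_bot := by
    rintro ⟨a⟩ C _ _ e he
    exact BooleanAlgebra.inf_compl_le_bot _
  top_le_sup_compl := by
    rintro ⟨a⟩ C _ _ e he
    exact BooleanAlgebra.top_le_sup_compl _
  le_top := by
    rintro ⟨a⟩ C _ _ e he
    exact le_top
  bot_le := by
    rintro ⟨a⟩ C _ _ e he
    exact bot_le

instance : GLPAlgebra β L (Alg Adm) where
  dia i := Quotient.map (.dia i) fun _ _ h C _ _ e he =>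
    congrArg (GLPAlgebra.dia L i) (h C e he)
  const c := Quotient.mk _ (.cst c)
  dia_bot i := Quotient.sound fun C _ _ e he => GLPAlgebra.dia_bot i
  dia_sup := by
    rintro i ⟨a⟩ ⟨b⟩
    exact Quotient.sound fun C _ _ e he => GLPAlgebra.dia_sup i _ _
  dia_loeb := by
    rintro i ⟨a⟩
    exact Quotient.sound fun C _ _ e he => GLPAlgebra.dia_loeb i _
  dia_anti := by
    rintro i j ⟨a⟩ h C _ _ e he
    exact GLPAlgebra.dia_anti i j _ h
  dia_le_box_dia := by
    rintro i j ⟨a⟩ h C _ _ e he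
    exact GLPAlgebra.dia_le_box_dia i j _ h

variable {Adm}

/-- Evaluation as a homomorphism on the term algebra. -/
def lift {C : Type x} [BooleanAlgebra C] [GLPAlgebra β L C] (e : S → C) (he : Adm C e) :
    GLPHom β L (Alg Adm) C where
  toFun := Quotient.lift (eval e) fun _ _ h => h C e he
  map_sup' := by rintro ⟨a⟩ ⟨b⟩; rfl
  map_inf' := by rintro ⟨a⟩ ⟨b⟩; rfl
  map_top' := rfl
  map_bot' := rfl
  map_dia' := by rintro i ⟨a⟩; rfl
  map_const' _ := rfl

theorem lift_unique {C : Type*} [BooleanAlgebra C] [GLPAlgebra β L C]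
    (h h' : GLPHom β L (Alg Adm) C)
    (H : ∀ s, h.toFun (Quotient.mk _ (.gen s)) = h'.toFun (Quotient.mk _ (.gen s))) : h = h' := by
  let q : GLPTerm β L S → Alg Adm := fun t => Quotient.mk _ t
  have key : ∀ t, h.toBoundedLatticeHom (q t) = h'.toBoundedLatticeHom (q t) := by
    intro t
    induction t with
    | gen s => exact H s
    | cst c => exact (h.map_const' c).trans (h'.map_const' c).symm
    | bot => exact h.map_bot'.trans h'.map_bot'.symm
    | top => exact h.map_top'.trans h'.map_top'.symm
    | inf a b iha ihb =>
      have e : q (a.inf b) = q a ⊓ q b := rfl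
      rw [e, map_inf, map_inf, iha, ihb]
    | sup a b iha ihb =>
      have e : q (a.sup b) = q a ⊔ q b := rfl
      rw [e, map_sup, map_sup, iha, ihb]
    | compl a iha =>
      have e : q a.compl = (q a)ᶜ := rfl
      rw [e, map_compl', map_compl', iha]
    | dia i a iha =>
      exact (h.map_dia' i (q a)).trans
        ((congrArg (GLPAlgebra.dia L i) iha).trans (h'.map_dia' i (q a)).symm)
  have : h.toBoundedLatticeHom = h'.toBoundedLatticeHom := by
    ext ⟨t⟩
    exact key t
  cases h; cases h'; cases this; rfl

end GLPTerm

/-- Every algebra has a free `l`-extension. -/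
theorem exists_isFreeExtension {α β : Type u} {K L : Type v} [LinearOrder α] [LinearOrder β]
    (l : TypeEmbedding α K β L) (A : Type w) [BooleanAlgebra A] [GLPAlgebra α K A] :
    ∃ (F : Type (max u v w)) (_ : BooleanAlgebra F) (_ : GLPAlgebra β L F)
      (e : GLPHom α K A (Puration l F)), IsFreeExtension l e := by
  let Adm : ∀ (C : Type (max u v w)) [BooleanAlgebra C] [GLPAlgebra β L C], (A → C) → Prop :=
    fun C _ _ e => ∃ g : GLPHom α K A (Puration l C), e = g.toFun
  refine ⟨GLPTerm.Alg Adm, inferInstance, inferInstance,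
    { toFun := fun a => (Quotient.mk _ (GLPTerm.gen a) : GLPTerm.Alg Adm)
      map_sup' := ?_
      map_inf' := ?_
      map_top' := ?_
      map_bot' := ?_
      map_dia' := ?_
      map_const' := ?_ }, ?_⟩
  · rintro a b
    refine Quotient.sound ?_
    rintro C _ _ _ ⟨g, rfl⟩
    exact g.map_sup' a b
  · rintro a b
    refine Quotient.sound ?_
    rintro C _ _ _ ⟨g, rfl⟩
    exact g.map_inf' a b
  · refine Quotient.sound ?_
    rintro C _ _ _ ⟨g, rfl⟩
    exact g.map_top'
  · refine Quotient.sound ?_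
    rintro C _ _ _ ⟨g, rfl⟩
    exact g.map_bot'
  · rintro i a
    refine Quotient.sound ?_
    rintro C _ _ _ ⟨g, rfl⟩
    exact g.map_dia' i a
  · rintro c
    refine Quotient.sound ?_
    rintro C _ _ _ ⟨g, rfl⟩
    exact g.map_const' c
  · intro C _ _ g
    refine ⟨GLPTerm.lift (Adm := Adm) g.toFun ⟨g, rfl⟩, fun a => rfl, fun h hh => ?_⟩
    exact GLPTerm.lift_unique _ _ fun a => hh a

/-- Free algebras exist. -/
theorem exists_isFreeGLPAlgebra (α : Type u) [LinearOrder α] (S : Type v) :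
    ∃ (F : Type (max u v)) (_ : BooleanAlgebra F) (_ : GLPAlgebra α Empty F) (e : S → F),
      IsFreeGLPAlgebra α e := by
  let Adm : ∀ (C : Type (max u v)) [BooleanAlgebra C] [GLPAlgebra α Empty C], (S → C) → Prop :=
    fun _ _ _ _ => True
  refine ⟨GLPTerm.Alg Adm, inferInstance, inferInstance, fun s => Quotient.mk _ (.gen s), ?_⟩
  intro C _ _ g
  refine ⟨GLPTerm.lift (Adm := Adm) g trivial, fun s => rfl, fun h hh => ?_⟩
  exact GLPTerm.lift_unique _ _ fun a => hh a

/-!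
Let the index `i` lie below a set `T` of indices, and let `S` be a Boolean subalgebra that is closed
under `◇ t` for `t ∈ T` and any two elements of which are comparable in `⊲ₜ ∪ ≡ₜ` for some `t ∈ T`.
The words `a₀ ⊓ ◇ᵢ (a₁ ⊓ ◇ᵢ (a₂ ⊓ ⋯))` with letters in `S` are then pairwise comparable in
`⊲ᵢ ∪ ≡ᵢ`: elements `◇ᵢ x` and their complements are invariant under `◇ t`, so that
`◇ t (a ⊓ ◇ᵢ x) = ◇ t a ⊓ ◇ᵢ x`, and the comparison of two words reduces to that of their first
letters unless a shorter word decides it. Finite joins of elements `u ⊓ (◇ᵢ v)ᶜ`, with `u` and `v`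
words, form a Boolean subalgebra closed under `◇ᵢ` and all `◇ t`, and each of them is `≡ᵢ` to a
word; so this subalgebra is linear with respect to `i`. An element of a free extension involves only
finitely many new operators, which can be adjoined in this way in descending order. The free
`∅`-generated algebra arises likewise from `S = {⊥, ⊤}` and `T = ∅`.
-/

open Set

namespace GLPAlgebra

section Operators

variable {β L F : Type*} [LinearOrder β] [BooleanAlgebra F] [GLPAlgebra β L F]
  {i j : β} {x y z u v : F}

theorem dia_mono (i : β) : Monotone (dia L i : F → F) := fun x y h => by
  rw [← sup_eq_right, dia_sup, sup_eq_right.2 h]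

theorem dia_anti_index (h : i ≤ j) (x : F) : dia L j x ≤ dia L i x := by
  rcases h.eq_or_lt with rfl | h
  · exact le_rfl
  · exact dia_anti i j x h

/-- Löb's axiom for `x ⊔ ◇ᵢ x` yields transitivity: the part of this element outside of
`◇ᵢ (x ⊔ ◇ᵢ x)` is below `x`. -/
theorem dia_dia_le (i : β) (x : F) : dia L i (dia L i x) ≤ dia L i x := by
  have le_x : (dia L i (x ⊔ dia L i x))ᶜ ⊓ (x ⊔ dia L i x) ≤ x := by
    rw [inf_sup_left]
    have disj : Disjoint (dia L i (x ⊔ dia L i x))ᶜ (dia L i x) :=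
      disjoint_compl_left.mono_right (dia_mono i le_sup_left)
    exact sup_le inf_le_right (disj.eq_bot.trans_le bot_le)
  calc dia L i (dia L i x) ≤ dia L i (x ⊔ dia L i x) := dia_mono i le_sup_right
    _ = dia L i ((dia L i (x ⊔ dia L i x))ᶜ ⊓ (x ⊔ dia L i x)) := (dia_loeb i _).symm
    _ ≤ dia L i x := dia_mono i le_x

theorem dia_dia_sup_self (i : β) (x : F) : dia L i (dia L i x ⊔ x) = dia L i x := by
  rw [← dia_sup, sup_eq_right.2 (dia_dia_le i x)]

theorem eq_bot_of_le_dia (h : x ≤ dia L i x) : x = ⊥ := by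
  have loeb := dia_loeb (K := L) i x
  rw [(disjoint_compl_left.mono_right h).eq_bot, dia_bot] at loeb
  rwa [← loeb, le_bot_iff] at h

variable (L) in
/-- The closure operator `x ↦ ◇ᵢ x ⊔ x`. Elements are `≡ᵢ` to each other if their closures agree. -/
def closureOperator (i : β) : ClosureOperator F :=
  .mk' (fun x => dia L i x ⊔ x) (fun _ _ h => sup_le_sup (dia_mono i h) h) (fun _ => le_sup_right)
    fun x => sup_le ((dia_dia_sup_self i x).trans_le le_sup_left) le_rfl

theorem Sim.symm (h : Sim L i x y) : Sim L i y x := Eq.symm h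

theorem Sim.trans (h : Sim L i x y) (h' : Sim L i y z) : Sim L i x z := Eq.trans h h'

theorem Sim.le (h : Sim L i x y) : x ≤ dia L i y ⊔ y := le_sup_right.trans (Eq.le h)

theorem Sim.of_le (h : x ≤ dia L i y ⊔ y) (h' : y ≤ dia L i x ⊔ x) : Sim L i x y :=
  le_antisymm ((closureOperator L i).le_closure_iff.1 h) ((closureOperator L i).le_closure_iff.1 h')

theorem Sim.anti_index (hij : i ≤ j) (h : Sim L j x y) : Sim L i x y :=
  .of_le (h.le.trans (sup_le_sup_right (dia_anti_index hij y) y))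
    (h.symm.le.trans (sup_le_sup_right (dia_anti_index hij x) x))

theorem Sim.dia_eq (h : Sim L i x y) : dia L i x = dia L i y := by
  rw [← dia_dia_sup_self i x, ← dia_dia_sup_self i y, show dia L i x ⊔ x = dia L i y ⊔ y from h]

theorem Sim.sup (h : Sim L i x u) (h' : Sim L i y v) : Sim L i (x ⊔ y) (u ⊔ v) :=
  calc closureOperator L i (x ⊔ y)
    _ = closureOperator L i (closureOperator L i x ⊔ closureOperator L i y) :=
      ((closureOperator L i).closure_sup_closure x y).symm
    _ = closureOperator L i (closureOperator L i u ⊔ closureOperator L i v) :=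
      congrArg₂ (fun a b => closureOperator L i (a ⊔ b)) h h'
    _ = closureOperator L i (u ⊔ v) := (closureOperator L i).closure_sup_closure u v

theorem Tri.dia_le (h : Tri L i x y) : dia L i y ≤ dia L i x :=
  (dia_mono i h).trans (dia_dia_le i x)

theorem Tri.trans (h : Tri L i x y) (h' : Tri L i y z) : Tri L i x z := le_trans h' h.dia_le

theorem Tri.anti_index (hij : i ≤ j) (h : Tri L j x y) : Tri L i x y :=
  le_trans h (dia_anti_index hij x)

theorem Tri.trans_sim (h : Tri L i x y) (h' : Sim L i y z) : Tri L i x z :=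
  h'.symm.le.trans (sup_le h.dia_le h)

theorem Sim.trans_tri (h : Sim L i x y) (h' : Tri L i y z) : Tri L i x z :=
  le_trans h' h.dia_eq.ge

variable (L) in
/-- `x` and `y` are comparable in the preorder `⊲ᵢ ∪ ≡ᵢ`. -/
def Comparable (i : β) (x y : F) : Prop := Tri L i x y ∨ Tri L i y x ∨ Sim L i x y

theorem Comparable.symm (h : Comparable L i x y) : Comparable L i y x := by
  rcases h with h | h | h
  · exact .inr (.inl h)
  · exact .inl h
  · exact .inr (.inr h.symm)

theorem Comparable.anti_index (hij : i ≤ j) (h : Comparable L j x y) : Comparable L i x y :=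
  h.imp (.anti_index hij) (.imp (.anti_index hij) (.anti_index hij))

theorem Comparable.congr (h : Comparable L i x y) (hx : Sim L i u x) (hy : Sim L i v y) :
    Comparable L i u v := by
  rcases h with h | h | h
  · exact .inl (hx.trans_tri (h.trans_sim hy.symm))
  · exact .inr (.inl (hy.trans_tri (h.trans_sim hx.symm)))
  · exact .inr (.inr (hx.trans (h.trans hy.symm)))

theorem Comparable.le_dia_or_dia_le (h : Comparable L i x y) :
    x ≤ dia L i y ∨ dia L i y ≤ dia L i x := by
  rcases h with h | h | h
  · exact .inr h.dia_le
  · exact .inl h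
  · exact .inr h.dia_eq.ge

theorem Comparable.dia_le_total (h : Comparable L i x y) :
    dia L i x ≤ dia L i y ∨ dia L i y ≤ dia L i x :=
  h.le_dia_or_dia_le.imp_left Tri.dia_le

theorem sim_inf_compl_dia (h : dia L i y ≤ dia L i x) : Sim L i (x ⊓ (dia L i y)ᶜ) x := by
  have dia_le : dia L i x ≤ dia L i (x ⊓ (dia L i y)ᶜ) :=
    calc dia L i x = dia L i ((dia L i x)ᶜ ⊓ x) := (dia_loeb i x).symm
      _ ≤ dia L i (x ⊓ (dia L i y)ᶜ) :=
        dia_mono i ((inf_comm _ x).trans_le (inf_le_inf_left x (compl_le_compl h)))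
  refine .of_le (inf_le_left.trans le_sup_right) ?_
  calc x = x ⊓ dia L i y ⊔ x ⊓ (dia L i y)ᶜ := (sup_inf_inf_compl).symm
    _ ≤ dia L i (x ⊓ (dia L i y)ᶜ) ⊔ x ⊓ (dia L i y)ᶜ :=
      sup_le_sup_right (inf_le_right.trans (h.trans dia_le)) _

theorem Comparable.inf_compl_dia_eq_bot_or_sim (h : Comparable L i x y) :
    x ⊓ (dia L i y)ᶜ = ⊥ ∨ Sim L i (x ⊓ (dia L i y)ᶜ) x :=
  h.le_dia_or_dia_le.imp (fun h => (disjoint_compl_right.mono_left h).eq_bot) sim_inf_compl_dia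

theorem Comparable.sup_sim_or_sim (h : Comparable L i x y) :
    Sim L i (x ⊔ y) x ∨ Sim L i (x ⊔ y) y := by
  have sim_left {x y : F} (h : y ≤ dia L i x ⊔ x) : Sim L i (x ⊔ y) x :=
    .of_le (sup_le le_sup_right h) (le_sup_left.trans le_sup_right)
  rcases h with h | h | h
  · exact .inl (sim_left (le_trans h le_sup_left))
  · exact .inr (sup_comm x y ▸ sim_left (le_trans h le_sup_left))
  · exact .inl (sim_left h.symm.le)

end Operators

section Linear

variable {β L F : Type*} [LinearOrder β] [BooleanAlgebra F] [GLPAlgebra β L F] {x y z : F}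

theorem Rel.trans (h : Rel β L x y) (h' : Rel β L y z) : Rel β L x z := by
  obtain ⟨i, h⟩ := h
  obtain ⟨j, h'⟩ := h'
  refine ⟨min i j, ?_⟩
  have hx := h.imp (Tri.anti_index (min_le_left i j)) (Sim.anti_index (min_le_left i j))
  have hy := h'.imp (Tri.anti_index (min_le_right i j)) (Sim.anti_index (min_le_right i j))
  rcases hx with hx | hx <;> rcases hy with hy | hy
  · exact .inl (hx.trans hy)
  · exact .inl (hx.trans_sim hy)
  · exact .inl (hx.trans_tri hy)
  · exact .inr (hx.trans hy)

theorem eq_bot_and_eq_bot_of_tri_of_sim {i j : β} (h : Tri L i x y) (h' : Sim L j x y) :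
    x = ⊥ ∧ y = ⊥ := by
  have tri_min : Tri L (min i j) x y := h.anti_index (min_le_left i j)
  have sim_min : Sim L (min i j) x y := h'.anti_index (min_le_right i j)
  obtain rfl : x = ⊥ := eq_bot_of_le_dia (L := L) (tri_min.trans_sim sim_min.symm)
  exact ⟨rfl, le_bot_iff.1 (h.trans_eq (dia_bot i))⟩

theorem IsLinear.of_exists_comparable [Nonempty β] (H : ∀ x y : F, ∃ i : β, Comparable L i x y) :
    IsLinear β L F where
  refl _ := ⟨Classical.arbitrary β, .inr rfl⟩
  trans _ _ _ := Rel.trans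
  total x y := by
    obtain ⟨i, h | h | h⟩ := H x y
    · exact .inl ⟨i, .inl h⟩
    · exact .inr ⟨i, .inl h⟩
    · exact .inl ⟨i, .inr h⟩
  inter := by
    ext ⟨x, y⟩
    simp only [mem_inter_iff, mem_iUnion, mem_ofPred_eq, mem_singleton_iff, Prod.mk.injEq]
    constructor
    · rintro ⟨⟨i, hi⟩, ⟨j, hj⟩⟩
      exact eq_bot_and_eq_bot_of_tri_of_sim hi hj
    · rintro ⟨rfl, rfl⟩
      exact ⟨⟨Classical.arbitrary β, bot_le⟩, ⟨Classical.arbitrary β, rfl⟩⟩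

theorem IsLinear.exists_comparable (H : IsLinear β L F) (x y : F) :
    ∃ i : β, Comparable L i x y := by
  rcases H.total x y with ⟨i, h | h⟩ | ⟨i, h | h⟩
  · exact ⟨i, .inl h⟩
  · exact ⟨i, .inr (.inr h)⟩
  · exact ⟨i, .inr (.inl h)⟩
  · exact ⟨i, .inr (.inr h.symm)⟩

variable (L) in
/-- `x` and `y` are comparable in `⊲ₜ ∪ ≡ₜ` for some `t ∈ T`, or they are comparable for the trivial
reason that they are equal or one of them is `⊥`. The trivial reasons matter for `T = ∅` only, where
they make the elements `⊥` and `⊤` comparable. -/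
def ComparableOn (T : Set β) (x y : F) : Prop :=
  x = y ∨ x = ⊥ ∨ y = ⊥ ∨ ∃ t ∈ T, Comparable L t x y

theorem ComparableOn.mono {T T' : Set β} (hT : T ⊆ T') (h : ComparableOn L T x y) :
    ComparableOn L T' x y :=
  h.imp_right (.imp_right (.imp_right fun ⟨t, ht, h⟩ => ⟨t, hT ht, h⟩))

theorem ComparableOn.comparable {T : Set β} {i : β} (h : ComparableOn L T x y)
    (hi : ∀ t ∈ T, i ≤ t) : Comparable L i x y := by
  rcases h with rfl | rfl | rfl | ⟨t, ht, h⟩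
  · exact .inr (.inr rfl)
  · exact .inr (.inl bot_le)
  · exact .inl bot_le
  · exact h.anti_index (hi t ht)

theorem ComparableOn.exists_comparable [Nonempty β] {T : Set β} (h : ComparableOn L T x y) :
    ∃ i : β, Comparable L i x y := by
  rcases h with rfl | rfl | rfl | ⟨t, -, h⟩
  · exact ⟨Classical.arbitrary β, .inr (.inr rfl)⟩
  · exact ⟨Classical.arbitrary β, .inr (.inl bot_le)⟩
  · exact ⟨Classical.arbitrary β, .inl bot_le⟩
  · exact ⟨t, h⟩

end Linear

section Stable

variable {β L F : Type*} [LinearOrder β] [BooleanAlgebra F] [GLPAlgebra β L F]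
  {i j : β} {a b p q : F}

variable (L) in
/-- `p` and its complement are both invariant under `◇ j`: in a Kripke frame, accessible points
agree on whether they satisfy `p`. -/
def IsStable (j : β) (p : F) : Prop := dia L j p ≤ p ∧ dia L j pᶜ ≤ pᶜ

theorem isStable_top (j : β) : IsStable L j (⊤ : F) := ⟨le_top, by rw [compl_top, dia_bot]⟩

theorem isStable_dia (h : i < j) (x : F) : IsStable L j (dia L i x) :=
  ⟨(dia_anti_index h.le _).trans (dia_dia_le i x),
    le_compl_comm.1 (dia_le_box_dia (K := L) i j x h)⟩

theorem IsStable.compl (h : IsStable L j p) : IsStable L j pᶜ :=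
  ⟨h.2, (compl_compl p).symm ▸ h.1⟩

theorem IsStable.dia_inf (h : IsStable L j p) (x : F) : dia L j (x ⊓ p) = dia L j x ⊓ p := by
  refine le_antisymm (le_inf (dia_mono j inf_le_left) ((dia_mono j inf_le_right).trans h.1)) ?_
  have dia_le : dia L j x ≤ dia L j (x ⊓ p) ⊔ pᶜ :=
    calc dia L j x = dia L j (x ⊓ p) ⊔ dia L j (x ⊓ pᶜ) := by rw [dia_sup, sup_inf_inf_compl]
      _ ≤ dia L j (x ⊓ p) ⊔ pᶜ := sup_le_sup_left ((dia_mono j inf_le_right).trans h.2) _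
  calc dia L j x ⊓ p ≤ (dia L j (x ⊓ p) ⊔ pᶜ) ⊓ p := inf_le_inf_right p dia_le
    _ = dia L j (x ⊓ p) ⊓ p := by rw [inf_sup_right, compl_inf_eq_bot, sup_bot_eq]
    _ ≤ dia L j (x ⊓ p) := inf_le_left

theorem Tri.inf_inf (h : Tri L j a b) (hp : IsStable L j p) (hbq : b ⊓ q ≤ p) :
    Tri L j (a ⊓ p) (b ⊓ q) :=
  (le_inf (inf_le_left.trans h) hbq).trans_eq (hp.dia_inf a).symm

theorem Sim.inf_inf (h : Sim L j a b) (hp : IsStable L j p) (hq : IsStable L j q)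
    (hap : a ⊓ p ≤ q) (hbq : b ⊓ q ≤ p) : Sim L j (a ⊓ p) (b ⊓ q) := by
  have le_closure {a b p q : F} (h : Sim L j a b) (hq : IsStable L j q) (hap : a ⊓ p ≤ q) :
      a ⊓ p ≤ dia L j (b ⊓ q) ⊔ b ⊓ q :=
    calc a ⊓ p ≤ (dia L j b ⊔ b) ⊓ q := le_inf (inf_le_left.trans h.le) hap
      _ = dia L j (b ⊓ q) ⊔ b ⊓ q := by rw [inf_sup_right, hq.dia_inf]
  exact .of_le (le_closure h hq hap) (le_closure h.symm hp hbq)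

theorem Comparable.inf_inf (h : Comparable L j a b) (hp : IsStable L j p) (hq : IsStable L j q)
    (hap : a ⊓ p ≤ q) (hbq : b ⊓ q ≤ p) : Comparable L j (a ⊓ p) (b ⊓ q) := by
  rcases h with h | h | h
  · exact .inl (h.inf_inf hp hbq)
  · exact .inr (.inl (h.inf_inf hq hap))
  · exact .inr (.inr (h.inf_inf hp hq hap hbq))

theorem ComparableOn.inf_inf {T : Set β} (h : ComparableOn L T a b)
    (hp : ∀ t ∈ T, IsStable L t p) (hq : ∀ t ∈ T, IsStable L t q)
    (hap : a ⊓ p ≤ q) (hbq : b ⊓ q ≤ p) : ComparableOn L T (a ⊓ p) (b ⊓ q) := by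
  rcases h with rfl | rfl | rfl | ⟨t, ht, h⟩
  · exact .inl (le_antisymm (le_inf inf_le_left hap) (le_inf inf_le_left hbq))
  · exact .inr (.inl (bot_inf_eq p))
  · exact .inr (.inr (.inl (bot_inf_eq q)))
  · exact .inr (.inr (.inr ⟨t, ht, h.inf_inf (hp t ht) (hq t ht) hap hbq⟩))

end Stable

section Worm

variable {β L F : Type*} [LinearOrder β] [BooleanAlgebra F] [GLPAlgebra β L F]

variable (L) in
/-- Words `a₀ ⊓ ◇ᵢ (a₁ ⊓ ◇ᵢ (⋯ ⊓ ◇ᵢ aₙ))` with letters in the subalgebra `S`. -/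
inductive IsWorm (i : β) (S : BooleanSubalgebra F) : F → Prop
  | letter {a : F} : a ∈ S → IsWorm i S a
  | cons {a w : F} : a ∈ S → IsWorm i S w → IsWorm i S (a ⊓ dia L i w)

variable {i : β} {S : BooleanSubalgebra F} {u v w x y : F}

theorem IsWorm.dia (hw : IsWorm L i S w) : IsWorm L i S (dia L i w) := by
  simpa only [top_inf_eq] using IsWorm.cons S.top_mem hw

theorem IsWorm.dia_of_lt {j : β} (hij : i < j) (hS : MapsTo (GLPAlgebra.dia L j) (S : Set F) S)
    (hw : IsWorm L i S w) : IsWorm L i S (GLPAlgebra.dia L j w) := by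
  cases hw with
  | letter ha => exact .letter (hS ha)
  | cons ha hw =>
    rw [(isStable_dia hij _).dia_inf]
    exact .cons (hS ha) hw

theorem IsWorm.comparable (hS : ∀ a ∈ S, ∀ b ∈ S, ComparableOn L (Ioi i) a b)
    (hu : IsWorm L i S u) (hv : IsWorm L i S v) : Comparable L i u v := by
  have inf_inf {a b p q : F} (ha : a ∈ S) (hb : b ∈ S) (hp : ∀ j > i, IsStable L j p)
      (hq : ∀ j > i, IsStable L j q) (hap : a ⊓ p ≤ q) (hbq : b ⊓ q ≤ p) :
      Comparable L i (a ⊓ p) (b ⊓ q) :=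
    ((hS a ha b hb).inf_inf hp hq hap hbq).comparable fun _ h => le_of_lt h
  have tri_of_dia_le {u b v : F} (h : GLPAlgebra.dia L i v ≤ GLPAlgebra.dia L i u) :
      Tri L i u (b ⊓ GLPAlgebra.dia L i v) := inf_le_right.trans h
  have stable_top (j) (_ : j > i) : IsStable L j (⊤ : F) := isStable_top j
  have stable_dia (x : F) (j) (h : j > i) : IsStable L j (GLPAlgebra.dia L i x) := isStable_dia h x
  induction hu generalizing v with
  | @letter a ha =>
    induction hv with
    | @letter b hb =>
      simpa only [inf_top_eq] using inf_inf ha hb stable_top stable_top le_top le_top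
    | @cons b v hb _ ihv =>
      rcases ihv.le_dia_or_dia_le with h | h
      · simpa only [inf_top_eq] using
          inf_inf ha hb stable_top (stable_dia v) (inf_le_left.trans h) le_top
      · exact .inl (tri_of_dia_le h)
  | @cons a u ha _ ihu =>
    induction hv with
    | @letter b hb =>
      rcases (ihu (.letter hb)).symm.le_dia_or_dia_le with h | h
      · simpa only [inf_top_eq] using
          inf_inf ha hb (stable_dia u) stable_top le_top (inf_le_left.trans h)
      · exact .inr (.inl (tri_of_dia_le h))
    | @cons b v hb hv ihv =>
      rcases ihv.le_dia_or_dia_le with h | h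
      · rcases (ihu (.cons hb hv)).symm.le_dia_or_dia_le with h' | h'
        · exact inf_inf ha hb (stable_dia u) (stable_dia v) h h'
        · exact .inr (.inl (tri_of_dia_le h'))
      · exact .inl (tri_of_dia_le h)

theorem IsWorm.inf (hS : ∀ a ∈ S, ∀ b ∈ S, ComparableOn L (Ioi i) a b)
    (hu : IsWorm L i S u) (hv : IsWorm L i S v) : IsWorm L i S (u ⊓ v) := by
  cases hu with
  | letter ha =>
    cases hv with
    | letter hb => exact .letter (S.inf_mem ha hb)
    | cons hb hv =>
      rw [← inf_assoc]
      exact .cons (S.inf_mem ha hb) hv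
  | cons ha hu =>
    cases hv with
    | letter hb =>
      rw [inf_right_comm]
      exact .cons (S.inf_mem ha hb) hu
    | cons hb hv =>
      rw [inf_inf_inf_comm]
      rcases (hu.comparable hS hv).dia_le_total with h | h
      · exact (inf_eq_left.2 h).symm ▸ .cons (S.inf_mem ha hb) hu
      · exact (inf_eq_right.2 h).symm ▸ .cons (S.inf_mem ha hb) hv

variable (L) in
/-- Finite joins of elements `u ⊓ (◇ᵢ v)ᶜ` with worms `u` and `v`. -/
inductive IsNormal (i : β) (S : BooleanSubalgebra F) : F → Prop
  | basic {u v : F} : IsWorm L i S u → IsWorm L i S v → IsNormal i S (u ⊓ (dia L i v)ᶜ)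
  | sup {x y : F} : IsNormal i S x → IsNormal i S y → IsNormal i S (x ⊔ y)

theorem IsWorm.isNormal (hu : IsWorm L i S u) : IsNormal L i S u := by
  simpa only [dia_bot, compl_bot, inf_top_eq] using IsNormal.basic hu (.letter S.bot_mem)

theorem IsWorm.isNormal_compl_dia (hv : IsWorm L i S v) :
    IsNormal L i S (GLPAlgebra.dia L i v)ᶜ := by
  simpa only [top_inf_eq] using IsNormal.basic (.letter S.top_mem) hv

theorem IsWorm.isNormal_compl (hu : IsWorm L i S u) : IsNormal L i S uᶜ := by
  cases hu with
  | letter ha => exact (IsWorm.letter (S.compl_mem ha)).isNormal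
  | cons ha hw =>
    rw [compl_inf]
    exact .sup (IsWorm.letter (S.compl_mem ha)).isNormal hw.isNormal_compl_dia

theorem IsNormal.inf (hS : ∀ a ∈ S, ∀ b ∈ S, ComparableOn L (Ioi i) a b)
    (hx : IsNormal L i S x) (hy : IsNormal L i S y) : IsNormal L i S (x ⊓ y) := by
  induction hx with
  | sup _ _ ih ih' => exact inf_sup_right _ _ y ▸ .sup ih ih'
  | @basic u v hu hv =>
    induction hy with
    | sup _ _ ih ih' => exact inf_sup_left (u ⊓ _) _ _ ▸ .sup ih ih'
    | @basic u' v' hu' hv' =>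
      rw [inf_inf_inf_comm, ← compl_sup]
      rcases (hv.comparable hS hv').dia_le_total with h | h
      · exact (sup_eq_right.2 h).symm ▸ .basic (hu.inf hS hu') hv'
      · exact (sup_eq_left.2 h).symm ▸ .basic (hu.inf hS hu') hv

theorem IsNormal.compl (hS : ∀ a ∈ S, ∀ b ∈ S, ComparableOn L (Ioi i) a b)
    (hx : IsNormal L i S x) : IsNormal L i S xᶜ := by
  induction hx with
  | sup _ _ ihx ihy => exact compl_sup (α := F) ▸ ihx.inf hS ihy
  | basic hu hv =>
    rw [compl_inf, compl_compl]
    exact .sup hu.isNormal_compl hv.dia.isNormal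

theorem IsNormal.dia_of_lt {j : β} (hij : i < j) (hS : MapsTo (dia L j) (S : Set F) S)
    (hx : IsNormal L i S x) : IsNormal L i S (dia L j x) := by
  induction hx with
  | sup _ _ ihx ihy => exact dia_sup (K := L) (X := F) j _ _ ▸ .sup ihx ihy
  | basic hu hv =>
    rw [(isStable_dia hij _).compl.dia_inf]
    exact .basic (hu.dia_of_lt hij hS) hv

theorem IsNormal.exists_isWorm_sim (hS : ∀ a ∈ S, ∀ b ∈ S, ComparableOn L (Ioi i) a b)
    (hx : IsNormal L i S x) : ∃ w, IsWorm L i S w ∧ Sim L i x w := by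
  induction hx with
  | basic hu hv =>
    rcases (hu.comparable hS hv).inf_compl_dia_eq_bot_or_sim with h | h
    · exact ⟨⊥, .letter S.bot_mem, h ▸ rfl⟩
    · exact ⟨_, hu, h⟩
  | sup _ _ ihx ihy =>
    obtain ⟨u, hu, hxu⟩ := ihx
    obtain ⟨v, hv, hyv⟩ := ihy
    rcases (hu.comparable hS hv).sup_sim_or_sim with h | h
    · exact ⟨u, hu, (hxu.sup hyv).trans h⟩
    · exact ⟨v, hv, (hxu.sup hyv).trans h⟩

theorem IsNormal.dia (hS : ∀ a ∈ S, ∀ b ∈ S, ComparableOn L (Ioi i) a b)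
    (hx : IsNormal L i S x) : IsNormal L i S (dia L i x) := by
  obtain ⟨w, hw, hxw⟩ := hx.exists_isWorm_sim hS
  exact hxw.dia_eq ▸ hw.dia.isNormal

theorem IsNormal.comparable (hS : ∀ a ∈ S, ∀ b ∈ S, ComparableOn L (Ioi i) a b)
    (hx : IsNormal L i S x) (hy : IsNormal L i S y) : Comparable L i x y := by
  obtain ⟨u, hu, hxu⟩ := hx.exists_isWorm_sim hS
  obtain ⟨v, hv, hyv⟩ := hy.exists_isWorm_sim hS
  exact (hu.comparable hS hv).congr hxu hyv

variable (L) in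
/-- The Boolean subalgebra of all joins of elements `u ⊓ (◇ᵢ v)ᶜ`, where `u` and `v` are worms. -/
def normalSubalgebra (i : β) (S : BooleanSubalgebra F)
    (hS : ∀ a ∈ S, ∀ b ∈ S, ComparableOn L (Ioi i) a b) : BooleanSubalgebra F where
  carrier := {x | IsNormal L i S x}
  supClosed' _ hx _ hy := .sup hx hy
  infClosed' _ hx _ hy := hx.inf hS hy
  compl_mem' hx := hx.compl hS
  bot_mem' := (IsWorm.letter S.bot_mem).isNormal

end Worm

section Generated

variable {β L F : Type*} [LinearOrder β] [BooleanAlgebra F] [GLPAlgebra β L F]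

variable (L) in
/-- `x` is obtained from elements of `S` by Boolean operations and the operators `◇ t`, `t ∈ T`. -/
inductive IsGenerated (T : Set β) (S : Set F) : F → Prop
  | of_mem {x : F} : x ∈ S → IsGenerated T S x
  | bot : IsGenerated T S ⊥
  | compl {x : F} : IsGenerated T S x → IsGenerated T S xᶜ
  | sup {x y : F} : IsGenerated T S x → IsGenerated T S y → IsGenerated T S (x ⊔ y)
  | dia {t : β} {x : F} : t ∈ T → IsGenerated T S x → IsGenerated T S (dia L t x)

variable {T T' : Set β} {S : Set F} {N : BooleanSubalgebra F} {x y : F}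

theorem IsGenerated.mono (hT : T ⊆ T') (hx : IsGenerated L T S x) : IsGenerated L T' S x := by
  induction hx with
  | of_mem h => exact .of_mem h
  | bot => exact .bot
  | compl _ ih => exact .compl ih
  | sup _ _ ih ih' => exact .sup ih ih'
  | dia ht _ ih => exact .dia (hT ht) ih

theorem IsGenerated.mem (hx : IsGenerated L T S x) (hS : S ⊆ (N : Set F))
    (hN : ∀ t ∈ T, MapsTo (GLPAlgebra.dia L t) (N : Set F) N) : x ∈ N := by
  induction hx with
  | of_mem h => exact hS h
  | bot => exact N.bot_mem
  | compl _ ih => exact N.compl_mem ih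
  | sup _ _ ih ih' => exact N.sup_mem ih ih'
  | dia ht _ ih => exact hN _ ht ih

theorem IsGenerated.exists_finset (hx : IsGenerated L T S x) :
    ∃ J : Finset β, IsGenerated L (J : Set β) S x := by
  classical
  induction hx with
  | of_mem h => exact ⟨∅, .of_mem h⟩
  | bot => exact ⟨∅, .bot⟩
  | compl _ ih => exact ih.imp fun _ => .compl
  | sup _ _ ih ih' =>
    obtain ⟨J, hx⟩ := ih
    obtain ⟨J', hy⟩ := ih'
    exact ⟨J ∪ J', .sup (hx.mono (by simp)) (hy.mono (by simp))⟩
  | @dia t _ _ _ ih =>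
    obtain ⟨J, hx⟩ := ih
    exact ⟨insert t J, .dia (by simp) (hx.mono (by simp))⟩

variable (L) in
/-- The smallest Boolean subalgebra that contains `S` and is closed under `◇ t` for `t ∈ T`. -/
def generatedSubalgebra (T : Set β) (S : Set F) : BooleanSubalgebra F where
  carrier := {x | IsGenerated L T S x}
  supClosed' _ hx _ hy := .sup hx hy
  infClosed' x hx y hy := by
    rw [← compl_compl (x ⊓ y), compl_inf]
    exact .compl (.sup hx.compl hy.compl)
  compl_mem' hx := .compl hx
  bot_mem' := .bot

theorem IsGenerated.isNormal_of_insert {i : β} (hi : ∀ t ∈ T, i < t)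
    (hT : ∀ a ∈ generatedSubalgebra L T S, ∀ b ∈ generatedSubalgebra L T S,
      ComparableOn L (Ioi i) a b)
    (hx : IsGenerated L (insert i T) S x) : IsNormal L i (generatedSubalgebra L T S) x := by
  refine hx.mem (N := normalSubalgebra L i _ hT)
    (fun a ha => (IsWorm.letter (IsGenerated.of_mem ha)).isNormal) ?_
  rintro t (rfl | ht) x hx
  · exact IsNormal.dia hT hx
  · exact IsNormal.dia_of_lt (hi t ht) (fun _ => .dia ht) hx

theorem comparableOn_of_isGenerated {S : BooleanSubalgebra F} (hT : IsUpperSet T)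
    (hS : ∀ a ∈ S, ∀ b ∈ S, ComparableOn L T a b) (hST : ∀ t ∈ T, MapsTo (dia L t) (S : Set F) S)
    (J : Finset β) (hx : IsGenerated L (T ∪ J) (S : Set F) x)
    (hy : IsGenerated L (T ∪ J) (S : Set F) y) : ComparableOn L (T ∪ J) x y := by
  induction J using Finset.induction_on_min generalizing x y with
  | empty =>
    simp only [Finset.coe_empty, union_empty] at hx hy ⊢
    exact hS x (hx.mem le_rfl hST) y (hy.mem le_rfl hST)
  | insert i J hJ ih =>
    rw [Finset.coe_insert, union_insert] at hx hy ⊢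
    by_cases hi : i ∈ T
    · rw [insert_eq_of_mem (mem_union_left _ hi)] at hx hy ⊢
      exact ih hx hy
    · have lt_of_mem : ∀ t ∈ T ∪ J, i < t := by
        rintro t (ht | ht)
        · exact lt_of_not_ge fun h => hi (hT h ht)
        · exact hJ t ht
      have comparable := fun a ha b hb => (ih (x := a) (y := b) ha hb).mono lt_of_mem
      exact .inr (.inr (.inr ⟨i, mem_insert i _,
        (hx.isNormal_of_insert lt_of_mem comparable).comparable comparable
          (hy.isNormal_of_insert lt_of_mem comparable)⟩))

theorem isLinear_of_isGenerated [Nonempty β] {S : BooleanSubalgebra F} (hT : IsUpperSet T)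
    (hS : ∀ a ∈ S, ∀ b ∈ S, ComparableOn L T a b) (hST : ∀ t ∈ T, MapsTo (dia L t) (S : Set F) S)
    (hF : ∀ x : F, IsGenerated L (univ : Set β) (S : Set F) x) : IsLinear β L F := by
  classical
  refine .of_exists_comparable fun x y => ?_
  obtain ⟨J, hx⟩ := (hF x).exists_finset
  obtain ⟨J', hy⟩ := (hF y).exists_finset
  have hJ : (J : Set β) ⊆ T ∪ ↑(J ∪ J') := fun _ ht => .inr (Finset.mem_union_left J' ht)
  have hJ' : (J' : Set β) ⊆ T ∪ ↑(J ∪ J') := fun _ ht => .inr (Finset.mem_union_right J ht)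
  exact (comparableOn_of_isGenerated hT hS hST _ (hx.mono hJ) (hy.mono hJ')).exists_comparable

end Generated

end GLPAlgebra

open GLPAlgebra

section Homomorphisms

variable {α K : Type*} [LinearOrder α] {X Y Z : Type*} [BooleanAlgebra X] [BooleanAlgebra Y]
  [BooleanAlgebra Z] [GLPAlgebra α K X] [GLPAlgebra α K Y] [GLPAlgebra α K Z]

variable (α K X) in
/-- The identity homomorphism. -/
def GLPHom.id : GLPHom α K X X where
  __ := BoundedLatticeHom.id X
  map_dia' _ _ := rfl
  map_const' _ := rfl

/-- The composition of homomorphisms. -/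
def GLPHom.comp (g : GLPHom α K Y Z) (h : GLPHom α K X Y) : GLPHom α K X Z where
  __ := g.toBoundedLatticeHom.comp h.toBoundedLatticeHom
  map_dia' i x := (congrArg g.toFun (h.map_dia' i x)).trans (g.map_dia' i (h.toFun x))
  map_const' c := (congrArg g.toFun (h.map_const' c)).trans (g.map_const' c)

theorem GLPHom.comparable (h : GLPHom α K X Y) {i : α} {x y : X} (hxy : Comparable K i x y) :
    Comparable K i (h.toFun x) (h.toFun y) := by
  have tri {x y : X} (hxy : Tri K i x y) : Tri K i (h.toFun x) (h.toFun y) :=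
    (OrderHomClass.mono h.toBoundedLatticeHom hxy).trans_eq (h.map_dia' i x)
  have map_closure (x : X) : h.toFun (dia K i x ⊔ x) = dia K i (h.toFun x) ⊔ h.toFun x :=
    (h.map_sup' _ _).trans (congrArg (· ⊔ h.toFun x) (h.map_dia' i x))
  rcases hxy with hxy | hxy | hxy
  · exact .inl (tri hxy)
  · exact .inr (.inl (tri hxy))
  · exact .inr (.inr ((map_closure x).symm.trans ((congrArg h.toFun hxy).trans (map_closure y))))

variable (α K X) in
/-- Boolean subalgebras that contain the constants and are closed under all operators `◇ i`. -/
structure GLPSubalgebra extends BooleanSubalgebra X where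
  dia_mem' : ∀ i : α, ∀ x ∈ carrier, dia K i x ∈ carrier
  const_mem' : ∀ c : K, const α c ∈ carrier

instance (U : GLPSubalgebra α K X) : GLPAlgebra α K U.toBooleanSubalgebra where
  dia i x := ⟨dia K i (x : X), U.dia_mem' i x x.2⟩
  const c := ⟨const α c, U.const_mem' c⟩
  dia_bot i := Subtype.ext (dia_bot i)
  dia_sup i x y := Subtype.ext (dia_sup i (x : X) y)
  dia_loeb i x := Subtype.ext (dia_loeb i (x : X))
  dia_anti i j x h := dia_anti (K := K) i j (x : X) h
  dia_le_box_dia i j x h := dia_le_box_dia (K := K) i j (x : X) h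

/-- The inclusion of a subalgebra as a homomorphism. -/
def GLPSubalgebra.subtype (U : GLPSubalgebra α K X) : GLPHom α K U.toBooleanSubalgebra X where
  __ := U.toBooleanSubalgebra.subtype
  map_dia' _ _ := rfl
  map_const' _ := rfl

theorem GLPSubalgebra.mem_of_subtype_comp_eq_id {U : GLPSubalgebra α K X}
    {h : GLPHom α K X U.toBooleanSubalgebra} (hh : U.subtype.comp h = GLPHom.id α K X) (x : X) :
    x ∈ U.toBooleanSubalgebra := by
  have val_eq : (h.toFun x : X) = x := congrArg (fun k : GLPHom α K X X => k.toFun x) hh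
  exact val_eq ▸ (h.toFun x).2

/-- The image of a homomorphism. -/
def GLPHom.range (h : GLPHom α K X Y) : GLPSubalgebra α K Y where
  __ := BooleanSubalgebra.map h.toBoundedLatticeHom ⊤
  dia_mem' := by
    rintro i _ ⟨x, -, rfl⟩
    exact ⟨dia K i x, mem_univ _, h.map_dia' i x⟩
  const_mem' c := ⟨const α c, mem_univ _, h.map_const' c⟩

end Homomorphisms

section FreeExtension

variable {α K β L : Type*} [LinearOrder α] [LinearOrder β] {l : TypeEmbedding α K β L}
  {A : Type*} [BooleanAlgebra A] [GLPAlgebra α K A] {F : Type x} [BooleanAlgebra F]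
  [GLPAlgebra β L F] {e : GLPHom α K A (Puration l F)}

/-- A homomorphism to a puration whose values lie in a subalgebra, as a homomorphism to the
puration of the subalgebra. -/
def GLPHom.codRestrict (e : GLPHom α K A (Puration l F)) (U : GLPSubalgebra β L F)
    (hU : ∀ a : A, (e.toFun a : F) ∈ U.toBooleanSubalgebra) :
    GLPHom α K A (Puration l U.toBooleanSubalgebra) where
  toFun a := (⟨e.toFun a, hU a⟩ : U.toBooleanSubalgebra)
  map_sup' a b := Subtype.ext (e.map_sup' a b)
  map_inf' a b := Subtype.ext (e.map_inf' a b)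
  map_top' := Subtype.ext e.map_top'
  map_bot' := Subtype.ext e.map_bot'
  map_dia' i a := Subtype.ext (e.map_dia' i a)
  map_const' c := Subtype.ext (e.map_const' c)

theorem IsFreeExtension.mem_subalgebra (he : IsFreeExtension l e) (U : GLPSubalgebra β L F)
    (hU : ∀ a : A, (e.toFun a : F) ∈ U.toBooleanSubalgebra) (x : F) :
    x ∈ U.toBooleanSubalgebra := by
  obtain ⟨h, hh, -⟩ := he U.toBooleanSubalgebra (e.codRestrict U hU)
  exact GLPSubalgebra.mem_of_subtype_comp_eq_id
    ((he F e).unique (fun a => congrArg Subtype.val (hh a)) fun _ => rfl) x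

theorem IsFreeExtension.isLinear (he : IsFreeExtension l e) (hcst : Function.Surjective l.cst)
    (hidx : IsUpperSet (range l.idx)) (hA : IsLinear α K A) : IsLinear β L F := by
  let S : BooleanSubalgebra F := e.range.toBooleanSubalgebra
  have comparable : ∀ a ∈ S, ∀ b ∈ S, ComparableOn L (range l.idx) a b := by
    rintro _ ⟨a, -, rfl⟩ _ ⟨b, -, rfl⟩
    obtain ⟨i, hi⟩ := hA.exists_comparable a b
    exact .inr (.inr (.inr ⟨l.idx i, mem_range_self i, e.comparable hi⟩))
  have mapsTo : ∀ t ∈ range l.idx, MapsTo (dia L t) (S : Set F) S := by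
    rintro _ ⟨i, rfl⟩ x hx
    exact e.range.dia_mem' i x hx
  let U : GLPSubalgebra β L F :=
    { generatedSubalgebra L univ (S : Set F) with
      dia_mem' := fun i _ hx => .dia (mem_univ i) hx
      const_mem' := hcst.forall.2 fun c => .of_mem (e.range.const_mem' c) }
  obtain ⟨i, -⟩ := hA.refl ⊥
  have : Nonempty β := ⟨l.idx i⟩
  exact isLinear_of_isGenerated hidx comparable mapsTo
    (he.mem_subalgebra U fun a => .of_mem ⟨a, mem_univ a, rfl⟩)

end FreeExtension

section FreeAlgebra

variable {α : Type*} [LinearOrder α] {S : Type*} {F : Type x} [BooleanAlgebra F]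
  [GLPAlgebra α Empty F] {e : S → F}

theorem IsFreeGLPAlgebra.mem_subalgebra (he : IsFreeGLPAlgebra α e) (U : GLPSubalgebra α Empty F)
    (hU : ∀ s : S, e s ∈ U.toBooleanSubalgebra) (x : F) : x ∈ U.toBooleanSubalgebra := by
  obtain ⟨h, hh, -⟩ := he U.toBooleanSubalgebra fun s => ⟨e s, hU s⟩
  exact GLPSubalgebra.mem_of_subtype_comp_eq_id
    ((he F e).unique (fun s => congrArg Subtype.val (hh s)) fun _ => rfl) x

theorem IsFreeGLPAlgebra.isLinear [Nonempty α] [IsEmpty S] (he : IsFreeGLPAlgebra α e) :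
    IsLinear α Empty F := by
  let two : BooleanSubalgebra F := ⊥
  have comparable : ∀ a ∈ two, ∀ b ∈ two, ComparableOn Empty (∅ : Set α) a b := by
    rintro a (rfl | rfl) b (rfl | rfl)
    · exact .inl rfl
    · exact .inr (.inl rfl)
    · exact .inr (.inr (.inl rfl))
    · exact .inl rfl
  let U : GLPSubalgebra α Empty F :=
    { generatedSubalgebra Empty univ (two : Set F) with
      dia_mem' := fun i _ hx => .dia (mem_univ i) hx
      const_mem' := nofun }
  exact isLinear_of_isGenerated isUpperSet_empty comparable (fun _ => False.elim)
    (he.mem_subalgebra U isEmptyElim)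

end FreeAlgebra

theorem mainTheorem6_general :
    (∀ (α β K L : Type*) [LinearOrder α] [LinearOrder β] (l : TypeEmbedding α K β L),
      Function.Surjective l.cst → IsUpperSet (range l.idx) →
      ∀ (A : Type*) [BooleanAlgebra A] [GLPAlgebra α K A], IsLinear α K A →
      ∀ (F : Type*) [BooleanAlgebra F] [GLPAlgebra β L F]
        (e : GLPHom α K A (Puration l F)), IsFreeExtension l e → IsLinear β L F) ∧
    (∀ (α : Type*) [LinearOrder α] [Nonempty α] (S : Type*) [IsEmpty S]
      (F : Type*) [BooleanAlgebra F] [GLPAlgebra α Empty F] (e : S → F),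
      IsFreeGLPAlgebra α e → IsLinear α Empty F) :=
  ⟨fun _ _ _ _ _ _ _ hcst hidx _ _ _ hA _ _ _ _ he => he.isLinear hcst hidx hA,
    fun _ _ _ _ _ _ _ _ _ he => he.isLinear⟩

theorem mainTheorem6 :
    (∀ (α β : Type u) (K L : Type v) [LinearOrder α] [LinearOrder β]
      (l : TypeEmbedding α K β L), l.IsFinal →
      ∀ (A : Type w) [BooleanAlgebra A] [GLPAlgebra α K A], GLPAlgebra.IsLinear α K A →
      ∀ (F : Type (max u v w)) [BooleanAlgebra F] [GLPAlgebra β L F]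
        (e : GLPHom α K A (Puration l F)), IsFreeExtension l e → GLPAlgebra.IsLinear β L F) ∧
    (∀ (α : Type u) [LinearOrder α] [Nonempty α]
      (F : Type u) [BooleanAlgebra F] [GLPAlgebra α Empty F],
      IsFreeGLPAlgebra α (Empty.elim : Empty → F) → GLPAlgebra.IsLinear α Empty F) :=
  have ⟨isLinear_freeExtension, isLinear_free⟩ :=
    mainTheorem6_general.{u, u, v, v, w, max u v w, u, 0, u}
  ⟨fun _ _ _ _ _ _ l hl A _ _ hA F _ _ e =>
      isLinear_freeExtension _ _ _ _ l hl.bijective_cst.2 hl.isUpperSet_range A hA F e,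
    fun α _ _ F _ _ => isLinear_free α Empty F Empty.elim⟩
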